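/- Let $K$ be an algebraically closed field of characteristic zero, and let $\varphi=(f_1,\dots,f_n):\mathbb A^n\to\mathbb A^n$ be a polynomial map over $K$, with $f_i\in K[x]=K[x_1,\dots,x_n]$. Suppose that $\varphi$ has degree two, i.e. the field extension $K(x_1,\dots,x_n)/K(f_1,\dots,f_n)$ has degree $2$, and that $\varphi$ has no contracted divisors, i.e. $\dim\varphi(V(h))=\dim V(h)$ for every irreducible $h\in K[x]$, where $V(h)\subset\mathbb A^n$ is the zero locus of $h$ and the dimension of a set is that of its Zariski closure. Let $\tau$ be the nontrivial element of the Galois group of $K(x_1,\dots,x_n)/K(f_1,\dots,f_n)$. Then the Jacobian determinant $|J(\varphi)|=\det(\partial f_i/\partial x_j)$ is an irreducible polynomial, and $$\tau\big(|J(\varphi)|\big)=-|J(\varphi)|.$$ Moreover, $V(|J(\varphi)|)$ is the unique branching divisor of $\varphi$. Here a branching divisor is a hypersurface $V(h)$ with $h\in K[x]$ irreducible that is not contracted by $\varphi$ (i.e. $\dim\varphi(V(h))=\dim V(h)$) and for which $h^2$ divides $H(f_1,\dots,f_n)$, where $H$ is the irreducible polynomial in $n$ variables, unique up to a nonzero constant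 factor, such that $h$ divides $H(f_1,\dots,f_n)$. -/

import Mathlib

noncomputable section

/-- A polynomial map `𝔸ⁿ → 𝔸ⁿ` over `K` is the tuple `f = (f₁, …, fₙ)` of its coordinate
polynomials; this is the map which it induces on points. -/
def polyMap {K : Type*} [Field K] {n : ℕ} (f : Fin n → MvPolynomial (Fin n) K)
    (a : Fin n → K) : Fin n → K :=
  fun i => MvPolynomial.eval a (f i)

/-- The Jacobian determinant `det (∂fᵢ/∂xⱼ)`. -/
def jacobianDet {K : Type*} [Field K] {n : ℕ} (f : Fin n → MvPolynomial (Fin n) K) :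
    MvPolynomial (Fin n) K :=
  (Matrix.of fun i j => MvPolynomial.pderiv j (f i)).det

/-- The rational function field `K(x₁, …, xₙ)`. -/
abbrev RatFunField (K : Type*) [Field K] (n : ℕ) : Type _ :=
  FractionRing (MvPolynomial (Fin n) K)

/-- The subfield `K(f) = K(f₁, …, fₙ)` of `K(x₁, …, xₙ)`. -/
abbrev subfieldOf {K : Type*} [Field K] {n : ℕ} (f : Fin n → MvPolynomial (Fin n) K) :
    IntermediateField K (RatFunField K n) :=
  IntermediateField.adjoin K
    (Set.range fun i => algebraMap (MvPolynomial (Fin n) K) (RatFunField K n) (f i))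

/-- The degree `[K(x) : K(f)]` (with value `0` if the extension is infinite). -/
def mapDegree {K : Type*} [Field K] {n : ℕ} (f : Fin n → MvPolynomial (Fin n) K) : ℕ :=
  Module.finrank (subfieldOf f) (RatFunField K n)

/-- The hypersurface `V(h)`. -/
def hypersurface {K : Type*} [Field K] {n : ℕ} (h : MvPolynomial (Fin n) K) :
    Set (Fin n → K) :=
  {a | MvPolynomial.eval a h = 0}

/-- The dimension of a subset of `𝔸ⁿ`, i.e. of its Zariski closure: the Krull dimension of the
coordinate ring `K[x] / I(X)`. -/
def affineDim {K : Type*} [Field K] {n : ℕ} (X : Set (Fin n → K)) : WithBot ℕ∞ :=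
  ringKrullDim (MvPolynomial (Fin n) K ⧸ MvPolynomial.vanishingIdeal K X)

/-- `X` is contracted by the polynomial map `f`: its image has smaller dimension. -/
def IsContracted {K : Type*} [Field K] {n : ℕ} (f : Fin n → MvPolynomial (Fin n) K)
    (X : Set (Fin n → K)) : Prop :=
  affineDim (polyMap f '' X) < affineDim X

/-- No irreducible hypersurface is contracted by `f`. -/
def NoContractedDivisors {K : Type*} [Field K] {n : ℕ}
    (f : Fin n → MvPolynomial (Fin n) K) : Prop :=
  ∀ h : MvPolynomial (Fin n) K, Irreducible h → ¬ IsContracted f (hypersurface h)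

/-- `H` is an image polynomial of `h`: it is irreducible and `h` divides `H(f₁, …, fₙ)`. -/
def IsImagePolynomial {K : Type*} [Field K] {n : ℕ} (f : Fin n → MvPolynomial (Fin n) K)
    (h H : MvPolynomial (Fin n) K) : Prop :=
  Irreducible H ∧ h ∣ MvPolynomial.aeval f H

/-- `X` is a branching divisor of `f`: it is an irreducible hypersurface `V(h)` which is not
contracted by `f`, and `h²` divides `H(f₁, …, fₙ)` for the image polynomial `H` of `h`
(which is unique up to a nonzero constant, as `X` is not contracted). -/
def IsBranchingDivisor {K : Type*} [Field K] {n : ℕ} (f : Fin n → MvPolynomial (Fin n) K)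
    (X : Set (Fin n → K)) : Prop :=
  ∃ h : MvPolynomial (Fin n) K, Irreducible h ∧ X = hypersurface h ∧ ¬ IsContracted f X ∧
    ∃ H : MvPolynomial (Fin n) K, IsImagePolynomial f h H ∧ h ^ 2 ∣ MvPolynomial.aeval f H

end

/-! Write φ for substitution of `f`. The quadratic extension K(x)/K(f) is generated by some s with τ
s = -s. Since K[x] is integrally closed, s can be chosen polynomial with s² = φ(d) and d squarefree
(`exists_isSquareRootGenerator`).

Absence of contracted divisors enters through one fact: if h and H are irreducible and h ∣ φ(H),
then h ∣ φ(G) forces H ∣ G (`dvd_of_not_isContracted`). Together with unique factorization it makes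
d irreducible (`IsSquareRootGenerator.irreducible_radicand`), then s irreducible
(`IsSquareRootGenerator.irreducible_root`).

It remains to see that the Jacobian determinant and s are associated. At each prime p the
coordinates are fractions of elements of φ(A) + φ(A)s with denominators prime to p
(`IsSquareRootGenerator.exists_localized`). Differentiating these relations shows that the
determinant divides s up to a factor prime to p (`jacobianDet_dvd`), hence divides s
(`dvd_of_forall_irreducible`). Conversely, h² ∣ φ(H) forces h to divide the determinant
(`dvd_jacobianDet_of_sq_dvd`). For h = s this gives associatedness; for an arbitrary branching
divisor it gives uniqueness. -/

section

/-! ### Quadratic extensions of factorial rings, with divisors preserved -/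

section AbstractDouble

variable {A R : Type*} [CommRing A] [UniqueFactorizationMonoid A]
  [CommRing R] [IsDomain R] [UniqueFactorizationMonoid R]

/-- A homomorphism under which every prime divisor of the target dominates a prime divisor of the
source. -/
structure PreservesDivisors (φ : A →+* R) : Prop where
  injective : Function.Injective φ
  isUnit_of_map : ∀ q, IsUnit (φ q) → IsUnit q
  dvd_of_dvd : ∀ h H G, Irreducible h → Irreducible H → h ∣ φ H → h ∣ φ G → H ∣ G

/-- `s` is a square root of the squarefree element `d` which generates the fraction field of `R`
over that of `A`. -/
structure IsSquareRootGenerator (φ : A →+* R) (d : A) (s : R) : Prop where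
  sq_eq : s ^ 2 = φ d
  squarefree : Squarefree d
  exists_mul_eq : ∀ r : R, ∃ a b c : A, c ≠ 0 ∧ φ c * r = φ a + φ b * s
  eq_zero : ∀ a b : A, φ a + φ b * s = 0 → a = 0 ∧ b = 0

variable {φ : A →+* R} {d : A} {s : R}

/-- Frac(A) ∩ R = A: in a reduced fraction u/v lying in R, a prime H of v has a prime h of R above
it, and h divides φ(u), so H divides u as well. -/
theorem PreservesDivisors.mem_range (hφ : PreservesDivisors φ) {u v : A} {r : R} (hv : v ≠ 0)
    (h : φ v * r = φ u) : ∃ q, r = φ q := by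
  obtain ⟨u', v', c, hcop, hu, hv'⟩ := UniqueFactorizationMonoid.exists_reduced_factors' u v hv
  have hc : c ≠ 0 := by rintro rfl; simp at hv'; exact hv hv'.symm
  have hc' : φ c ≠ 0 := (map_ne_zero_iff φ hφ.injective).2 hc
  have h1 : φ v' * r = φ u' := by
    apply mul_left_cancel₀ hc'
    rw [← mul_assoc, ← map_mul, ← map_mul, hu, hv', h]
  by_cases hunit : IsUnit v'
  · obtain ⟨w, rfl⟩ := hunit
    refine ⟨↑w⁻¹ * u', ?_⟩
    rw [map_mul, ← h1, ← mul_assoc, ← map_mul]; simp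
  · have hv0 : v' ≠ 0 := by rintro rfl; simp at hv'; exact hv hv'.symm
    obtain ⟨H, hH, hHv⟩ := WfDvdMonoid.exists_irreducible_factor hunit hv0
    obtain ⟨h0, hh0, hd⟩ := WfDvdMonoid.exists_irreducible_factor
      (fun hu => hH.not_isUnit (hφ.isUnit_of_map H hu))
      ((map_ne_zero_iff φ hφ.injective).2 hH.ne_zero)
    have := hφ.dvd_of_dvd h0 H u' hh0 hH hd
      (h1 ▸ Dvd.dvd.mul_right (hd.trans (map_dvd φ hHv)) r)
    exact absurd (hcop this hHv) hH.not_isUnit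

omit [UniqueFactorizationMonoid R] in
/-- The relation expressing `r` through `s` can be taken in lowest terms at `H`. -/
theorem IsSquareRootGenerator.exists_reduced (hφ : PreservesDivisors φ)
    (hs : IsSquareRootGenerator φ d s) (r : R) {H : A} (hH : Irreducible H) :
    ∃ a b c : A, c ≠ 0 ∧ φ c * r = φ a + φ b * s ∧ ¬ (H ∣ a ∧ H ∣ b ∧ H ∣ c) := by
  obtain ⟨a, b, c, hc, h⟩ := hs.exists_mul_eq r
  have wf : WellFounded (DvdNotUnit (α := A)) := wellFounded_dvdNotUnit
  induction c using wf.induction generalizing a b with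
  | _ c ih =>
    by_cases hd : H ∣ a ∧ H ∣ b ∧ H ∣ c
    · obtain ⟨⟨a', rfl⟩, ⟨b', rfl⟩, ⟨c', rfl⟩⟩ := hd
      have hc' : c' ≠ 0 := right_ne_zero_of_mul hc
      refine ih c' ⟨hc', H, hH.not_isUnit, mul_comm _ _⟩ a' b' hc' ?_
      apply mul_left_cancel₀ ((map_ne_zero_iff φ hφ.injective).2 hH.ne_zero)
      simp only [map_mul] at h
      linear_combination h
    · exact ⟨a, b, c, hc, h, hd⟩

/-- Every prime divisor of the target lies over one of the source. -/
theorem IsSquareRootGenerator.exists_irreducible (hφ : PreservesDivisors φ)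
    (hs : IsSquareRootGenerator φ d s) {h : R} (hh : Irreducible h) :
    ∃ H : A, Irreducible H ∧ h ∣ φ H := by
  obtain ⟨a, b, c, hc, e⟩ := hs.exists_mul_eq h
  -- The norm of c h: multiply by the conjugate a - b s. One of its prime factors will be the
  -- required H.
  have hd : h ∣ φ (a ^ 2 - b ^ 2 * d) := ⟨φ c * (φ a - φ b * s), by
    simp only [map_sub, map_mul, map_pow, ← hs.sq_eq]; linear_combination (-(φ a - φ b * s)) * e⟩
  have h0 : a ^ 2 - b ^ 2 * d ≠ 0 := by
    intro h0
    have : (φ a + φ b * s) * (φ a + φ (-b) * s) = 0 := by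
      have := congrArg φ h0
      simp only [map_sub, map_mul, map_pow, ← hs.sq_eq, map_zero, map_neg] at this ⊢
      linear_combination this
    have hab : a = 0 ∧ b = 0 := by
      rcases mul_eq_zero.1 this with h | h
      · exact hs.eq_zero _ _ h
      · simpa using hs.eq_zero _ _ h
    rw [hab.1, hab.2] at e
    simp at e
    rcases e with e | e
    · exact hc (hφ.injective (by simpa using e))
    · exact hh.ne_zero e
  generalize a ^ 2 - b ^ 2 * d = N at hd h0
  clear e
  induction N using WfDvdMonoid.induction_on_irreducible with
  | zero => exact absurd rfl h0
  | unit u hu => exact absurd (isUnit_of_dvd_unit hd (hu.map φ)) hh.not_isUnit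
  | mul a i ha hi ih =>
    rw [map_mul] at hd
    rcases hh.prime.dvd_or_dvd hd with hd | hd
    · exact ⟨i, hi, hd⟩
    · exact ih hd ha

/-- If the divisor under `h` is ramified, then the denominators can be taken prime to it. -/
theorem IsSquareRootGenerator.exists_of_dvd (hφ : PreservesDivisors φ)
    (hs : IsSquareRootGenerator φ d s) (r : R) {H : A} (hH : Irreducible H)
    (hHd : H ∣ d) :
    ∃ a b c : A, ¬ H ∣ c ∧ φ c * r = φ a + φ b * s := by
  obtain ⟨a, b, c, hc, e, hn⟩ := hs.exists_reduced hφ r hH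
  refine ⟨a, b, c, fun hHc => hn ?_, e⟩
  obtain ⟨h, hh, hd⟩ := WfDvdMonoid.exists_irreducible_factor
      (fun hu => hH.not_isUnit (hφ.isUnit_of_map H hu))
      ((map_ne_zero_iff φ hφ.injective).2 hH.ne_zero)
  have hsd : h ∣ s := hh.prime.dvd_of_dvd_pow (hs.sq_eq ▸ hd.trans (map_dvd φ hHd))
  have hHa : H ∣ a := by
    refine hφ.dvd_of_dvd h H a hh hH hd ?_
    have : φ a = φ c * r - φ b * s := by linear_combination -e
    rw [this]
    exact dvd_sub (Dvd.dvd.mul_right (hd.trans (map_dvd φ hHc)) r) (Dvd.dvd.mul_left hsd _)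
  refine ⟨hHa, ?_, hHc⟩
  obtain ⟨d', rfl⟩ := hHd
  have hd' : ¬ H ∣ d' := fun h' => hH.not_isUnit (hs.squarefree H (mul_dvd_mul_left H h'))
  -- Squaring this and cancelling one φ(H) puts b² d' under h; squarefreeness keeps H out of d', so
  -- H ∣ b.
  obtain ⟨k, hk⟩ : φ H ∣ φ b * s := by
    have : φ b * s = φ c * r - φ a := by linear_combination -e
    rw [this]
    exact dvd_sub (Dvd.dvd.mul_right (map_dvd φ hHc) r) (map_dvd φ hHa)
  have h2 : φ (b ^ 2 * d') = φ H * k ^ 2 := by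
    apply mul_left_cancel₀ ((map_ne_zero_iff φ hφ.injective).2 hH.ne_zero)
    have e2 := hs.sq_eq
    simp only [map_mul, map_pow] at e2 ⊢
    linear_combination (φ b * s + φ H * k) * hk - φ b ^ 2 * e2
  have := hφ.dvd_of_dvd h H (b ^ 2 * d') hh hH hd (h2 ▸ Dvd.dvd.mul_right hd _)
  rcases hH.prime.dvd_or_dvd this with h3 | h3
  · exact hH.prime.dvd_of_dvd_pow h3
  · exact absurd h3 hd'

/-- `R` agrees with `A + A s` after localization at any prime divisor of `R`. -/
theorem IsSquareRootGenerator.exists_localized (hφ : PreservesDivisors φ)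
    (hs : IsSquareRootGenerator φ d s) (h2 : IsUnit (2 : A)) {h : R} (hh : Irreducible h) (r : R) :
    ∃ a b a' b' : A, ¬ h ∣ φ a + φ b * s ∧ (φ a + φ b * s) * r = φ a' + φ b' * s := by
  obtain ⟨H, hH, hhH⟩ := hs.exists_irreducible hφ hh
  by_cases hHd : H ∣ d
  · obtain ⟨a, b, c, hc, e⟩ := hs.exists_of_dvd hφ r hH hHd
    exact ⟨c, 0, a, b, fun h' => hc (hφ.dvd_of_dvd h H c hh hH hhH (by simpa using h')),
      by simpa using e⟩
  obtain ⟨a, b, c, hc, e, hn⟩ := hs.exists_reduced hφ r hH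
  by_cases hHc : H ∣ c
  -- The denominator is replaced by the conjugate a - b s, since (a - b s) r has the form φ(q). If h
  -- divided it, h would also divide a + b s = c r, hence 2a and b s, and H would divide a, b and c.
  · obtain ⟨q, hq⟩ := hφ.mem_range (u := a ^ 2 - b ^ 2 * d) (r := (φ a + φ (-b) * s) * r) hc (by
      simp only [map_sub, map_mul, map_pow, ← hs.sq_eq, map_neg]
      linear_combination (φ a - φ b * s) * e)
    refine ⟨a, -b, q, 0, fun h1 => hn ?_, by simpa using hq⟩
    have h3 : h ∣ φ a + φ b * s := e ▸ Dvd.dvd.mul_right (hhH.trans (map_dvd φ hHc)) r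
    have ha : H ∣ 2 * a := by
      refine hφ.dvd_of_dvd h H _ hh hH hhH ?_
      have : φ (2 * a) = (φ a + φ b * s) + (φ a + φ (-b) * s) := by rw [map_mul, map_ofNat, map_neg]; ring
      exact this ▸ dvd_add h3 h1
    have ha : H ∣ a := h2.dvd_mul_left.1 ha
    refine ⟨ha, ?_, hHc⟩
    have hb : h ∣ φ b * s := (dvd_add_right (hhH.trans (map_dvd φ ha))).1 h3
    rcases hh.prime.dvd_or_dvd hb with hb | hb
    · exact hφ.dvd_of_dvd h H _ hh hH hhH hb
    · exact absurd (hφ.dvd_of_dvd h H d hh hH hhH (hs.sq_eq ▸ Dvd.dvd.pow hb two_ne_zero)) hHd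
  · exact ⟨c, 0, a, b, fun h' => hHc (hφ.dvd_of_dvd h H c hh hH hhH (by simpa using h')),
      by simpa using e⟩

variable [Nontrivial A]

/-- If d = H d', the coprime elements φ(H) and φ(d') have product s², so H becomes a square in R up
to a unit. An element of A that becomes a square is, up to squares in Frac(A), either 1 or d. The
first is impossible for a prime; the second makes d' a unit. -/
theorem IsSquareRootGenerator.irreducible_radicand (hφ : PreservesDivisors φ)
    (hs : IsSquareRootGenerator φ d s) (h2 : IsUnit (2 : A))
    (hunits : ∀ u : R, IsUnit u → ∃ v : A, IsUnit v ∧ u = φ v)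
    (hd : ¬ IsUnit d) : Irreducible d := by
  obtain ⟨H, hH, d', rfl⟩ := WfDvdMonoid.exists_irreducible_factor hd hs.squarefree.ne_zero
  have hHd' : ¬ H ∣ d' := fun h' => hH.not_isUnit (hs.squarefree H (mul_dvd_mul_left H h'))
  have hsd' : Squarefree d' := hs.squarefree.squarefree_of_dvd (dvd_mul_left _ _)
  classical
  let : GCDMonoid R := UniqueFactorizationMonoid.toGCDMonoid R
  have hcop : IsUnit (gcd (φ H) (φ d')) := by
    by_contra hg
    have h0 : gcd (φ H) (φ d') ≠ 0 := fun h0 =>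
      (map_ne_zero_iff φ hφ.injective).2 hH.ne_zero ((gcd_eq_zero_iff _ _).1 h0).1
    obtain ⟨h, hh, hdvd⟩ := WfDvdMonoid.exists_irreducible_factor hg h0
    exact hHd' (hφ.dvd_of_dvd h H d' hh hH (hdvd.trans (gcd_dvd_left _ _))
      (hdvd.trans (gcd_dvd_right _ _)))
  obtain ⟨g, u, hu⟩ := exists_associated_pow_of_mul_eq_pow hcop
    (show φ H * φ d' = s ^ 2 by rw [hs.sq_eq, map_mul])
  obtain ⟨v, hv, huv⟩ := hunits u u.isUnit
  -- The unit comes from A, so it can be absorbed into H.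
  obtain ⟨H₀, hH₀⟩ : ∃ H₀, H = H₀ * v := by
    obtain ⟨w, rfl⟩ := hv
    exact ⟨H * ↑w⁻¹, by simp⟩
  have hHH : Associated H₀ H := ⟨hv.unit, by simp [hH₀]⟩
  have hH₀i : Irreducible H₀ := hHH.irreducible_iff.2 hH
  have hg : g ^ 2 = φ H₀ := by
    rw [hH₀, map_mul, huv] at hu
    exact mul_right_cancel₀ ((map_ne_zero_iff φ hφ.injective).2 hv.ne_zero) hu
  obtain ⟨a, b, c, hc, e⟩ := hs.exists_mul_eq g
  have e2 := hs.sq_eq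
  -- Coefficients of 1 and s in (c g)² = (a + b s)²; the second gives a b = 0.
  have key := hs.eq_zero (a ^ 2 + b ^ 2 * (H * d') - c ^ 2 * H₀) (2 * a * b) (by
    simp only [map_sub, map_add, map_mul, map_pow, map_ofNat, ← hg] at e2 ⊢
    linear_combination -(φ c * g + φ a + φ b * s) * e - φ b ^ 2 * e2)
  have hab : a = 0 ∨ b = 0 := by
    rcases mul_eq_zero.1 key.2 with h | h
    · exact .inl ((mul_eq_zero.1 h).resolve_left h2.ne_zero)
    · exact .inr h
  rcases hab with rfl | rfl
  · have e3 : b ^ 2 * (v * d') = c ^ 2 := by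
      apply mul_left_cancel₀ hH₀i.ne_zero
      have := key.1
      rw [hH₀] at this
      linear_combination this
    have hbc : b ∣ c := (UniqueFactorizationMonoid.pow_dvd_pow_iff_dvd two_ne_zero).1 ⟨_, e3.symm⟩
    obtain ⟨k, rfl⟩ := hbc
    have hb : b ≠ 0 := left_ne_zero_of_mul hc
    have e4 : v * d' = k ^ 2 := by
      apply mul_left_cancel₀ (pow_ne_zero 2 hb); rw [e3]; ring
    have hk : IsUnit k := hsd' k (by
      rw [← pow_two, ← e4]; exact (hv.mul_left_dvd).2 dvd_rfl)
    have hd'u : IsUnit d' := isUnit_of_mul_isUnit_right (e4 ▸ hk.pow 2)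
    exact (irreducible_mul_isUnit hd'u).2 hH
  · exfalso
    have e3 : a ^ 2 = c ^ 2 * H₀ := by linear_combination key.1
    have hca : c ∣ a := (UniqueFactorizationMonoid.pow_dvd_pow_iff_dvd two_ne_zero).1 ⟨_, e3⟩
    obtain ⟨k, rfl⟩ := hca
    have e4 : H₀ = k * k := by
      apply mul_left_cancel₀ (pow_ne_zero 2 hc); rw [← e3]; ring
    have hk := hH₀i.isUnit_or_isUnit e4
    exact hH₀i.not_isUnit (e4 ▸ (hk.elim id id).mul (hk.elim id id))

/-- A prime factor h of s satisfies c h = a + b s with d ∤ c. Then d ∣ a, so s ∣ c h; every prime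
factor of s lies over d and so misses c, which leaves s ∣ h. -/
theorem IsSquareRootGenerator.irreducible_root (hφ : PreservesDivisors φ)
    (hs : IsSquareRootGenerator φ d s) (hd : Irreducible d) : Irreducible s := by
  have hsu : ¬ IsUnit s := fun hu => hd.not_isUnit (hφ.isUnit_of_map _ (hs.sq_eq ▸ hu.pow 2))
  have hs0 : s ≠ 0 := by
    rintro rfl
    exact one_ne_zero (hs.eq_zero 0 1 (by simp)).2
  obtain ⟨h, hh, hhs⟩ := WfDvdMonoid.exists_irreducible_factor hsu hs0
  obtain ⟨a, b, c, hc, e⟩ := hs.exists_of_dvd hφ h hd dvd_rfl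
  have hda : d ∣ a := by
    refine hφ.dvd_of_dvd h d a hh hd (hs.sq_eq ▸ Dvd.dvd.pow hhs two_ne_zero) ?_
    have : φ a = φ c * h - φ b * s := by linear_combination -e
    exact this ▸ dvd_sub (dvd_mul_left _ _) (Dvd.dvd.mul_left hhs _)
  have hsd : s ∣ φ d := hs.sq_eq ▸ dvd_pow_self s two_ne_zero
  have hsc : s ∣ φ c * h :=
    e ▸ dvd_add (hsd.trans (map_dvd φ hda)) (dvd_mul_left _ _)
  have hsh : s ∣ h := by
    refine UniqueFactorizationMonoid.dvd_of_dvd_mul_right_of_no_prime_factors hs0 ?_ hsc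
    intro k hks hkc hk
    exact hc (hφ.dvd_of_dvd k d c hk.irreducible hd (hks.trans hsd) hkc)
  exact (associated_of_dvd_dvd hhs hsh).irreducible_iff.1 hh

end AbstractDouble

open MvPolynomial

/-! ### Dimension of images of hypersurfaces -/

section Geometry

variable {K : Type*} [Field K]

/-- Translations permute the points, so all maximal ideals have the same height, and the supremum of
these heights is the dimension n. -/
theorem height_vanishingIdeal_singleton {n : ℕ} [IsAlgClosed K] (a : Fin n → K) :
    ((vanishingIdeal K {a} : Ideal (MvPolynomial (Fin n) K)).height : WithBot ℕ∞) = n := by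
  have htrans : ∀ b : Fin n → K,
      (vanishingIdeal K {b} : Ideal (MvPolynomial (Fin n) K)).height =
        (vanishingIdeal K {a} : Ideal (MvPolynomial (Fin n) K)).height := by
    intro b
    let e : MvPolynomial (Fin n) K ≃ₐ[K] MvPolynomial (Fin n) K :=
      AlgEquiv.ofAlgHom (aeval fun i => X i + C (a i - b i)) (aeval fun i => X i - C (a i - b i))
        (by ext i; simp) (by ext i; simp)
    have he : ∀ p, eval b (e p) = eval a p := by
      intro p
      have : (aeval b).comp e.toAlgHom = (aeval a : MvPolynomial (Fin n) K →ₐ[K] K) := by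
        ext i; simp [e]
      simpa [aeval_eq_eval] using DFunLike.congr_fun this p
    have : (vanishingIdeal K {b} : Ideal (MvPolynomial (Fin n) K)).comap e.toRingEquiv =
        vanishingIdeal K {a} := by
      ext p
      simp [he, Ideal.mem_comap, mem_vanishingIdeal_iff, aeval_eq_eval]
    rw [← this, RingEquiv.height_comap]
  have h1 := Ideal.sup_isMaximal_height_eq_ringKrullDim (R := MvPolynomial (Fin n) K)
  rw [MvPolynomial.ringKrullDim_of_isNoetherianRing, ringKrullDim_eq_zero_of_field] at h1
  simp only [Nat.card_eq_fintype_card, Fintype.card_fin, zero_add] at h1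
  rw [← h1]
  congr 1
  apply le_antisymm
  · exact le_iSup₂_of_le (vanishingIdeal K {a})
      (isMaximal_iff_eq_vanishingIdeal_singleton.2 ⟨a, rfl⟩) le_rfl
  · refine iSup₂_le fun I hI => ?_
    obtain ⟨b, rfl⟩ := isMaximal_iff_eq_vanishingIdeal_singleton.1 hI
    exact (htrans b).le

theorem le_ringKrullDim_quotient_span_add_one {n : ℕ} [IsAlgClosed K]
    {h : MvPolynomial (Fin n) K} (hh : ¬ IsUnit h) :
    (n : WithBot ℕ∞) ≤ ringKrullDim (MvPolynomial (Fin n) K ⧸ Ideal.span {h}) + 1 := by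
  obtain ⟨m, hm, hhm⟩ := exists_max_ideal_of_mem_nonunits hh
  obtain ⟨a, rfl⟩ := isMaximal_iff_eq_vanishingIdeal_singleton.1 hm
  rw [← height_vanishingIdeal_singleton a]
  exact Ideal.height_le_ringKrullDim_quotient_add_one hhm

/-- H and then G, which is nonzero in the domain A/(H), each lower the dimension by one. -/
theorem ringKrullDim_quotient_add_two_le {A : Type*} [CommRing A] [IsDomain A] {P : Ideal A}
    {H G : A} (hH : Prime H) (hHP : H ∈ P) (hG : G ∈ P)
    (hHG : ¬ H ∣ G) : ringKrullDim (A ⧸ P) + 1 + 1 ≤ ringKrullDim A := by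
  have : (Ideal.span {H}).IsPrime := (Ideal.span_singleton_prime hH.ne_zero).2 hH
  have h1 := ringKrullDim_quotient_succ_le_of_nonZeroDivisor
    (mem_nonZeroDivisors_of_ne_zero hH.ne_zero)
  refine le_trans ?_ h1
  gcongr
  refine ringKrullDim_succ_le_of_surjective
    (Ideal.Quotient.factor ((Ideal.span_singleton_le_iff_mem _).2 hHP))
    (Ideal.Quotient.factor_surjective _) (r := Ideal.Quotient.mk _ G)
    (mem_nonZeroDivisors_of_ne_zero ?_) ?_
  · rwa [Ne, Ideal.Quotient.eq_zero_iff_mem, Ideal.mem_span_singleton]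
  · simpa [Ideal.Quotient.eq_zero_iff_mem] using hG

theorem vanishingIdeal_hypersurface {n : ℕ} [IsAlgClosed K] {h : MvPolynomial (Fin n) K}
    (hh : Irreducible h) :
    vanishingIdeal K (hypersurface h) = Ideal.span {h} := by
  have : (Ideal.span {h}).IsPrime := (Ideal.span_singleton_prime hh.ne_zero).2 hh.prime
  have e : hypersurface h = zeroLocus K (Ideal.span {h}) := by
    rw [zeroLocus_span]; ext; simp [hypersurface, aeval_eq_eval]
  rw [e, MvPolynomial.IsPrime.vanishingIdeal_zeroLocus]

theorem eval_polyMap {n : ℕ} (f : Fin n → MvPolynomial (Fin n) K) (a : Fin n → K)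
    (G : MvPolynomial (Fin n) K) : eval (polyMap f a) G = eval a (aeval f G) := by
  rw [← aeval_eq_eval, ← aeval_eq_eval, ← AlgHom.comp_apply]
  congr 1
  ext i; simp [polyMap, aeval_eq_eval]

theorem mem_vanishingIdeal_image {n : ℕ} (f : Fin n → MvPolynomial (Fin n) K)
    (X : Set (Fin n → K)) (G : MvPolynomial (Fin n) K) :
    G ∈ vanishingIdeal K (polyMap f '' X) ↔ aeval f G ∈ vanishingIdeal K X := by
  simp [mem_vanishingIdeal_iff, aeval_eq_eval, eval_polyMap]

/-- If `V(h)` is not contracted, its image polynomial generates the ideal of its image. -/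
theorem dvd_of_not_isContracted {n : ℕ} [IsAlgClosed K] {f : Fin n → MvPolynomial (Fin n) K}
    {h H G : MvPolynomial (Fin n) K} (hh : Irreducible h) (hH : Irreducible H)
    (hc : ¬ IsContracted f (hypersurface h)) (hhH : h ∣ aeval f H) (hhG : h ∣ aeval f G) :
    H ∣ G := by
  by_contra hHG
  apply hc
  have hmem : ∀ F, h ∣ aeval f F → F ∈ vanishingIdeal K (polyMap f '' hypersurface h) := by
    intro F hF
    rwa [mem_vanishingIdeal_image, vanishingIdeal_hypersurface hh, Ideal.mem_span_singleton]
  have h1 := ringKrullDim_quotient_add_two_le hH.prime (hmem H hhH) (hmem G hhG) hHG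
  have h2 := le_ringKrullDim_quotient_span_add_one hh.not_isUnit
  rw [MvPolynomial.ringKrullDim_of_isNoetherianRing, ringKrullDim_eq_zero_of_field] at h1
  simp only [Nat.card_eq_fintype_card, Fintype.card_fin, zero_add] at h1
  unfold IsContracted affineDim
  rw [vanishingIdeal_hypersurface hh]
  generalize ringKrullDim (MvPolynomial (Fin n) K ⧸ Ideal.span {h}) = x at *
  generalize ringKrullDim (MvPolynomial (Fin n) K ⧸
    vanishingIdeal K (polyMap f '' hypersurface h)) = y at *
  have h3 : y + 1 + 1 ≤ x + 1 := h1.trans h2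
  clear hmem
  -- Cancelling the 1 needs finite values: `h1` excludes y = ⊤ and `h2` excludes x = ⊥.
  induction y with
  | bot =>
    rw [bot_lt_iff_ne_bot]
    rintro rfl
    simp at h2
  | coe y =>
    induction y with
    | top =>
      have : ((⊤ : ℕ∞) + 1 + 1) ≤ (n : ℕ∞) := WithBot.coe_le_coe.1 h1
      simp at this
    | coe y =>
      induction x with
      | bot => simp at h2
      | coe x =>
        induction x with
        | top => exact WithBot.coe_lt_coe.2 (ENat.natCast_lt_top y)
        | coe x =>
          norm_cast at h3 ⊢
          omega

end Geometry

/-! ### Derivatives and divisibility of the Jacobian determinant -/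

section Jacobian

variable {K : Type*} [Field K]

theorem pderiv_aeval {σ ι : Type*} [Fintype ι] (f : ι → MvPolynomial σ K) (j : σ)
    (p : MvPolynomial ι K) :
    pderiv j (aeval f p) = ∑ k, aeval f (pderiv k p) * pderiv j (f k) := by
  classical
  induction p using MvPolynomial.induction_on with
  | C a => simp
  | add p q hp hq => simp only [map_add, hp, hq, add_mul, Finset.sum_add_distrib]
  | mul_X p i hp =>
    simp only [map_mul, aeval_X, Derivation.leibniz, hp, smul_eq_mul, pderiv_X, map_add,
      add_mul, Finset.sum_add_distrib, Finset.mul_sum, mul_assoc]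
    congr 1
    simp [Pi.single_apply]

theorem totalDegree_pderiv_lt {σ : Type*} (p : MvPolynomial σ K) (i : σ) (h : pderiv i p ≠ 0) :
    (pderiv i p).totalDegree < p.totalDegree := by
  classical
  rw [totalDegree, Finset.sup_lt_iff]
  · intro m hm
    rw [mem_support_iff, coeff_pderiv] at hm
    have := le_totalDegree (mem_support_iff.2 (left_ne_zero_of_mul hm))
    rw [Finsupp.sum_add_index' (fun _ => rfl) (fun _ _ _ => rfl)] at this
    simp at this
    omega
  · obtain ⟨m, hm⟩ := ne_zero_iff.1 h
    rw [coeff_pderiv] at hm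
    have := le_totalDegree (mem_support_iff.2 (left_ne_zero_of_mul hm))
    rw [Finsupp.sum_add_index' (fun _ => rfl) (fun _ _ _ => rfl)] at this
    simp at this
    simp
    omega

theorem eq_zero_of_dvd_pderiv {σ : Type*} {p : MvPolynomial σ K} {i : σ} (h : p ∣ pderiv i p) :
    pderiv i p = 0 := by
  by_contra h0
  obtain ⟨q, hq⟩ := h
  have := totalDegree_pderiv_lt p i h0
  rw [hq] at this h0
  rw [totalDegree_mul_of_isDomain (left_ne_zero_of_mul h0) (right_ne_zero_of_mul h0)] at this
  omega

theorem exists_pderiv_ne_zero [CharZero K] {σ : Type*} {p : MvPolynomial σ K} (h0 : p ≠ 0)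
    (h : ¬ IsUnit p) : ∃ i, pderiv i p ≠ 0 := by
  classical
  rw [isUnit_iff_totalDegree_of_isReduced] at h
  by_contra! hp
  apply h
  have key : ∀ m ∈ p.support, m = 0 := by
    intro m hm
    ext i
    by_contra hi
    have h1 := congrArg (coeff (m - Finsupp.single i 1)) (hp i)
    have hle : Finsupp.single i 1 ≤ m := by
      simpa [Finsupp.single_le_iff] using Nat.one_le_iff_ne_zero.2 hi
    rw [coeff_pderiv, tsub_add_cancel_of_le hle, coeff_zero, mul_eq_zero] at h1
    rcases h1 with h1 | h1
    · exact mem_support_iff.1 hm h1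
    · exact Nat.cast_add_one_ne_zero _ h1
  have hdeg : p.totalDegree = 0 := by
    rw [totalDegree_eq_zero_iff]
    intro m hm i
    rw [key m hm]; rfl
  refine ⟨?_, hdeg⟩
  rw [totalDegree_eq_zero_iff_eq_C] at hdeg
  rw [isUnit_iff_ne_zero]
  intro hc
  rw [hdeg, hc, C_0] at h0
  exact h0 rfl

theorem isUnit_two_mvPolynomial [CharZero K] {σ : Type*} : IsUnit (2 : MvPolynomial σ K) := by
  have := (isUnit_iff_ne_zero.2 (two_ne_zero (α := K))).map (C : K →+* MvPolynomial σ K)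
  rwa [map_ofNat] at this

variable {n : ℕ} {f : Fin n → MvPolynomial (Fin n) K}

/-- The Jacobian determinant vanishes along every divisor with ramification. -/
theorem dvd_jacobianDet {h G : MvPolynomial (Fin n) K} (hh : Irreducible h) {k : Fin n}
    (hk : ¬ h ∣ aeval f (pderiv k G)) (hG : h ^ 2 ∣ aeval f G) : h ∣ jacobianDet f := by
  have : (Ideal.span {h}).IsPrime := (Ideal.span_singleton_prime hh.ne_zero).2 hh.prime
  have hz : ∀ p, Ideal.Quotient.mk (Ideal.span {h}) p = 0 ↔ h ∣ p := by
    intro p; rw [Ideal.Quotient.eq_zero_iff_mem, Ideal.mem_span_singleton]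
  rw [← hz, jacobianDet, RingHom.map_det, ← Matrix.exists_vecMul_eq_zero_iff]
  -- By the chain rule, the pulled-back gradient of G is a left kernel vector of the Jacobian matrix
  -- modulo h.
  refine ⟨fun i => Ideal.Quotient.mk _ (aeval f (pderiv i G)), fun h0 => hk ?_, ?_⟩
  · exact (hz _).1 (congrFun h0 k)
  · ext j
    have : Ideal.Quotient.mk (Ideal.span {h}) (pderiv j (aeval f G)) = 0 := by
      rw [hz]
      obtain ⟨q, hq⟩ := hG
      rw [hq, pow_two, mul_assoc, Derivation.leibniz, smul_eq_mul, smul_eq_mul]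
      exact dvd_add (dvd_mul_right _ _) (dvd_mul_of_dvd_left (dvd_mul_right _ _) _)
    rw [pderiv_aeval, map_sum] at this
    simpa [Matrix.vecMul, dotProduct] using this

/-- A rank-one perturbation of t M loses at most one power of t from the determinant; a Schur
complement shows this without dividing by t. -/
theorem pow_dvd_mul_det_add_vecMulVec {R ι : Type*} [CommRing R] [Fintype ι] [DecidableEq ι]
    (t : R) (M : Matrix ι ι R) (w g : ι → R) :
    t ^ Fintype.card ι ∣ (t • M + Matrix.vecMulVec w g).det * t := by
  let Z := Matrix.fromBlocks M (Matrix.replicateCol Unit w) (-Matrix.replicateRow Unit g)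
    (t • (1 : Matrix Unit Unit R))
  have e : Z * Matrix.fromBlocks (t • (1 : Matrix ι ι R)) 0 (Matrix.replicateRow Unit g) 1 =
      Matrix.fromBlocks (t • M + Matrix.vecMulVec w g) (Matrix.replicateCol Unit w) 0
        (t • (1 : Matrix Unit Unit R)) := by
    rw [Matrix.fromBlocks_multiply]
    congr 1
    · rw [Matrix.vecMulVec_eq Unit]; simp
    · simp
    · simp
    · simp
  have e2 := congrArg Matrix.det e
  rw [Matrix.det_mul, Matrix.det_fromBlocks_zero₁₂, Matrix.det_fromBlocks_zero₂₁] at e2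
  simp only [Matrix.det_smul, Matrix.det_one, mul_one, Fintype.card_unit, pow_one] at e2
  exact ⟨Z.det, by rw [← e2, mul_comm]⟩

/-- Integral relations expressing multiples of the coordinates through the `fᵢ` and a square root
`s` bound the Jacobian determinant. -/
theorem jacobianDet_dvd [CharZero K] {d s : MvPolynomial (Fin n) K} (hs : s ^ 2 = aeval f d)
    (hs0 : s ≠ 0)
    (a b a' b' : Fin n → MvPolynomial (Fin n) K)
    (h : ∀ i, (aeval f (a i) + aeval f (b i) * s) * X i = aeval f (a' i) + aeval f (b' i) * s) :
    jacobianDet f ∣ s * ∏ i, (aeval f (a i) + aeval f (b i) * s) := by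
  classical
  set c : Fin n → MvPolynomial (Fin n) K := fun i => aeval f (a i) + aeval f (b i) * s with hc
  let M : Matrix (Fin n) (Fin n) (MvPolynomial (Fin n) K) := Matrix.of fun i k =>
    aeval f (pderiv k (a' i)) + s * aeval f (pderiv k (b' i)) -
      X i * (aeval f (pderiv k (a i)) + s * aeval f (pderiv k (b i)))
  let w : Fin n → MvPolynomial (Fin n) K := fun i => aeval f (b' i) - X i * aeval f (b i)
  let g : Fin n → MvPolynomial (Fin n) K := fun k => aeval f (pderiv k d)
  let J : Matrix (Fin n) (Fin n) (MvPolynomial (Fin n) K) :=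
    Matrix.of fun i j => pderiv j (f i)
  -- The derivative of s has denominator 2s; multiplying all relations by 2s keeps the matrices
  -- polynomial and makes this term of rank one.
  have hg : ∀ j, 2 * s * pderiv j s = ∑ k, g k * pderiv j (f k) := by
    intro j
    have := congrArg (pderiv j) hs
    rw [pderiv_aeval, pderiv_pow] at this
    rw [← this]; simp
  have key : (2 * s) • Matrix.diagonal c = ((2 * s) • M + Matrix.vecMulVec w g) * J := by
    ext1 i j
    have h1 := congrArg (pderiv j) (h i)
    simp only [Derivation.leibniz, map_add, smul_eq_mul, pderiv_X, pderiv_aeval] at h1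
    have h2 : Matrix.diagonal c i j =
        c i * (Pi.single j 1 : Fin n → MvPolynomial (Fin n) K) i := by
      by_cases hij : i = j
      · subst hij; simp
      · simp [hij]
    have h3 : (((2 * s) • M + Matrix.vecMulVec w g) * J) i j =
        2 * s * (∑ k, aeval f (pderiv k (a' i)) * pderiv j (f k)
          + s * ∑ k, aeval f (pderiv k (b' i)) * pderiv j (f k)
          - X i * (∑ k, aeval f (pderiv k (a i)) * pderiv j (f k)
            + s * ∑ k, aeval f (pderiv k (b i)) * pderiv j (f k)))
        + w i * ∑ k, g k * pderiv j (f k) := by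
      simp only [Matrix.mul_apply, Finset.mul_sum, ← Finset.sum_add_distrib,
        ← Finset.sum_sub_distrib]
      refine Finset.sum_congr rfl fun k _ => ?_
      simp only [Matrix.add_apply, Matrix.smul_apply, Matrix.vecMulVec_apply, M, J, Matrix.of_apply,
        smul_eq_mul]
      ring
    rw [h3, ← hg, Matrix.smul_apply, h2, smul_eq_mul]
    simp only [hc, w]
    linear_combination (2 * s) * h1
  have h2s : (2 * s) ≠ 0 := mul_ne_zero two_ne_zero hs0
  obtain ⟨z, hz⟩ := pow_dvd_mul_det_add_vecMulVec (2 * s) M w g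
  have e := congrArg Matrix.det key
  rw [Matrix.det_mul, Matrix.det_smul, Matrix.det_diagonal] at e
  -- The rank-one term costs a single factor 2s, which is why s, and no higher power, appears in the
  -- bound.
  have e2 : 2 * s * ∏ i, c i = z * jacobianDet f := by
    apply mul_left_cancel₀ (pow_ne_zero (Fintype.card (Fin n)) h2s)
    have hJ : J.det = jacobianDet f := rfl
    rw [hJ] at e
    linear_combination (2 * s) * e + jacobianDet f * hz
  rw [← isUnit_two_mvPolynomial.dvd_mul_left, ← mul_assoc, e2]
  exact dvd_mul_left _ _

end Jacobian

/-! ### Involutions of quadratic field extensions -/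

section Quadratic

variable {F L : Type*} [Field F] [Field L] [Algebra F L]

theorem exists_ne_zero_apply_eq_neg (hdeg : Module.finrank F L = 2) (τ : L ≃ₐ[F] L) (hτ : τ ≠ 1) :
    ∃ s : L, s ≠ 0 ∧ τ s = -s := by
  classical
  have : FiniteDimensional F L := .of_finrank_pos (by omega)
  -- Otherwise 1, τ, τ² would be three automorphisms of an extension of degree 2.
  have hsq : τ * τ = 1 := by
    by_contra h
    have h1 : ({1, τ, τ * τ} : Finset (L ≃ₐ[F] L)).card = 3 := by
      rw [Finset.card_eq_three]
      exact ⟨1, τ, τ * τ, hτ.symm, Ne.symm h, fun h' => hτ (by simpa using h'), rfl⟩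
    have h2 := Finset.card_le_univ ({1, τ, τ * τ} : Finset (L ≃ₐ[F] L))
    have h3 := AlgEquiv.card_le (F := F) (K := L)
    omega
  obtain ⟨x, hx⟩ : ∃ x, τ x ≠ x := by
    by_contra! h
    exact hτ (AlgEquiv.ext h)
  refine ⟨x - τ x, sub_ne_zero.2 hx.symm, ?_⟩
  have : τ (τ x) = x := DFunLike.congr_fun hsq x
  rw [map_sub, this, neg_sub]

theorem exists_eq_add_mul_of_apply_eq_neg [CharZero L] (hdeg : Module.finrank F L = 2)
    (τ : L ≃ₐ[F] L) {s : L} (hs0 : s ≠ 0) (hs : τ s = -s) (y : L) :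
    ∃ α β : F, y = algebraMap F L α + algebraMap F L β * s := by
  have hli : LinearIndependent F ![1, s] := by
    rw [LinearIndependent.pair_iff]
    intro a b hab
    rw [Algebra.smul_def, Algebra.smul_def, mul_one] at hab
    have hab' := congrArg τ hab
    simp only [map_add, map_mul, AlgEquiv.commutes, hs, map_zero] at hab'
    have ha : 2 * algebraMap F L a = 0 := by linear_combination hab + hab'
    have ha : algebraMap F L a = 0 := by simpa using ha
    rw [ha, zero_add, mul_eq_zero, or_iff_left hs0] at hab
    exact ⟨by simpa using ha, by simpa using hab⟩
  have hspan := hli.span_eq_top_of_card_eq_finrank (by simp [hdeg])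
  have hy : y ∈ Submodule.span F (Set.range ![1, s]) := hspan ▸ Submodule.mem_top
  rw [Matrix.range_cons_cons_empty, Submodule.mem_span_pair] at hy
  obtain ⟨a, b, rfl⟩ := hy
  exact ⟨a, b, by simp [Algebra.smul_def]⟩

theorem exists_sq_eq_of_apply_eq_neg [CharZero L] (hdeg : Module.finrank F L = 2)
    (τ : L ≃ₐ[F] L) {s : L} (hs0 : s ≠ 0) (hs : τ s = -s) : ∃ α : F, s ^ 2 = algebraMap F L α := by
  obtain ⟨α, β, h⟩ := exists_eq_add_mul_of_apply_eq_neg hdeg τ hs0 hs (s ^ 2)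
  have h' := congrArg τ h
  simp only [map_add, map_mul, map_pow, AlgEquiv.commutes, hs] at h'
  have : 2 * (algebraMap F L β * s) = 0 := by linear_combination h' - h
  have : algebraMap F L β * s = 0 := by simpa using this
  exact ⟨α, by rw [h, this, add_zero]⟩

end Quadratic

/-! ### Polynomial maps of degree two -/

section Map

variable {K : Type*} [Field K] {n : ℕ} {f : Fin n → MvPolynomial (Fin n) K}

open scoped IntermediateField.algebraAdjoinAdjoin in
-- K(x) is algebraic over K[f], and n elements with this property in transcendence degree n form a
-- transcendence basis.
theorem algebraicIndependent_of_mapDegree_ne_zero (hdeg : mapDegree f ≠ 0) :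
    AlgebraicIndependent K f := by
  let x : Fin n → RatFunField K n := fun i => algebraMap _ _ (f i)
  have : FiniteDimensional (subfieldOf f) (RatFunField K n) :=
    .of_finrank_pos (Nat.pos_of_ne_zero hdeg)
  have : Algebra.IsAlgebraic (Algebra.adjoin K (Set.range x)) (RatFunField K n) :=
    Algebra.IsAlgebraic.trans _ (subfieldOf f) _
  have : Algebra.IsAlgebraic (MvPolynomial (Fin n) K) (RatFunField K n) :=
    IsLocalization.isAlgebraic _ (nonZeroDivisors (MvPolynomial (Fin n) K))
  have hb := (IsTranscendenceBasis.mvPolynomial (Fin n) K).algebraMap_comp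
    (A := RatFunField K n)
  have hx : IsTranscendenceBasis K x :=
    Algebra.IsAlgebraic.isTranscendenceBasis_of_lift_le_trdeg_of_finite K x
      hb.lift_cardinalMk_eq_trdeg.le
  exact AlgebraicIndependent.of_comp
    (IsScalarTower.toAlgHom K (MvPolynomial (Fin n) K) (RatFunField K n)) hx.1

theorem isUnit_iff_exists_C {σ : Type*} {u : MvPolynomial σ K} :
    IsUnit u ↔ ∃ c : K, c ≠ 0 ∧ u = C c := by
  rw [isUnit_iff_eq_C_of_isReduced]
  simp [isUnit_iff_ne_zero]

theorem preservesDivisors_aeval [IsAlgClosed K] (hdeg : mapDegree f ≠ 0)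
    (hcontr : NoContractedDivisors f) :
    PreservesDivisors (aeval f : MvPolynomial (Fin n) K →ₐ[K] MvPolynomial (Fin n) K).toRingHom where
  injective := algebraicIndependent_of_mapDegree_ne_zero hdeg
  isUnit_of_map q hq := by
    obtain ⟨c, hc, e⟩ := isUnit_iff_exists_C.1 hq
    refine isUnit_iff_exists_C.2 ⟨c, hc, algebraicIndependent_of_mapDegree_ne_zero hdeg ?_⟩
    exact e.trans (algHom_C _ c).symm
  dvd_of_dvd h H G hh hH hhH hhG := dvd_of_not_isContracted hh hH (hcontr h hh) hhH hhG

theorem exists_eq_div (α : subfieldOf f) : ∃ u v : MvPolynomial (Fin n) K, aeval f v ≠ 0 ∧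
    (α : RatFunField K n) * algebraMap _ _ (aeval f v) = algebraMap _ _ (aeval f u) := by
  obtain ⟨r, s, h⟩ := (IntermediateField.mem_adjoin_range_iff K _ _).1 α.2
  have e : ∀ p : MvPolynomial (Fin n) K, aeval (fun i => algebraMap (MvPolynomial (Fin n) K)
      (RatFunField K n) (f i)) p = algebraMap _ _ (aeval f p) := fun p =>
    aeval_algebraMap_apply _ f p
  rw [e, e] at h
  -- A zero denominator makes the quotient 0 by convention, so 0/1 represents it.
  by_cases hs : aeval f s = 0
  · refine ⟨0, 1, by simp, ?_⟩
    rw [h, hs]; simp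
  · refine ⟨r, s, hs, ?_⟩
    rw [h, div_mul_cancel₀]
    simpa using hs

theorem apply_algebraMap_aeval (τ : RatFunField K n ≃ₐ[subfieldOf f] RatFunField K n)
    (p : MvPolynomial (Fin n) K) :
    τ (algebraMap (MvPolynomial (Fin n) K) (RatFunField K n) (aeval f p)) =
      algebraMap _ _ (aeval f p) := by
  have : algebraMap (MvPolynomial (Fin n) K) (RatFunField K n) (aeval f p) ∈ subfieldOf f := by
    rw [subfieldOf, IntermediateField.mem_adjoin_range_iff]
    exact ⟨p, 1, by rw [map_one, div_one]; exact (aeval_algebraMap_apply _ f p).symm⟩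
  exact τ.commutes ⟨_, this⟩

/-- Descent on the degree of d: a square factor q² of d gives φ(q) ∣ s, and dividing s by the
τ-invariant φ(q) preserves the sign rule. -/
theorem exists_squarefree_radicand (hinj : Function.Injective
      (aeval f : MvPolynomial (Fin n) K →ₐ[K] MvPolynomial (Fin n) K))
    (τ : RatFunField K n ≃ₐ[subfieldOf f] RatFunField K n) (N : ℕ) :
    ∀ d s : MvPolynomial (Fin n) K, d.totalDegree = N → s ≠ 0 → s ^ 2 = aeval f d →
      τ (algebraMap _ _ s) = -algebraMap _ _ s →
      ∃ d s : MvPolynomial (Fin n) K, s ≠ 0 ∧ s ^ 2 = aeval f d ∧ Squarefree d ∧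
        τ (algebraMap _ _ s) = -algebraMap _ _ s := by
  induction N using Nat.strong_induction_on with
  | _ N ih =>
    intro d s hN hs0 hs hτ
    by_cases hd : Squarefree d
    · exact ⟨d, s, hs0, hs, hd, hτ⟩
    obtain ⟨q, ⟨d', rfl⟩, hq⟩ : ∃ q, q * q ∣ d ∧ ¬ IsUnit q := by
      simpa [Squarefree] using hd
    have hd0 : q * q * d' ≠ 0 := by
      intro h0
      rw [h0, map_zero] at hs
      exact hs0 (by simpa using hs)
    have hq0 : q ≠ 0 := left_ne_zero_of_mul (left_ne_zero_of_mul hd0)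
    have hfq0 : aeval f q ≠ 0 := (map_ne_zero_iff _ hinj).2 hq0
    have hqs : aeval f q ∣ s := by
      rw [← UniqueFactorizationMonoid.pow_dvd_pow_iff_dvd two_ne_zero, hs, map_mul, map_mul, pow_two]
      exact dvd_mul_right _ _
    obtain ⟨s', rfl⟩ := hqs
    refine ih d'.totalDegree ?_ d' s' rfl (right_ne_zero_of_mul hs0) ?_ ?_
    · rw [← hN, totalDegree_mul_of_isDomain (left_ne_zero_of_mul hd0) (right_ne_zero_of_mul hd0),
        totalDegree_mul_of_isDomain hq0 hq0]
      have : q.totalDegree ≠ 0 := by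
        intro h0
        rw [totalDegree_eq_zero_iff_eq_C] at h0
        refine hq (isUnit_iff_exists_C.2 ⟨_, fun hc => hq0 ?_, h0⟩)
        rw [h0, hc, C_0]
      omega
    · apply mul_left_cancel₀ (pow_ne_zero 2 hfq0)
      simp only [map_mul] at hs
      linear_combination hs
    · rw [map_mul, map_mul, apply_algebraMap_aeval, ← mul_neg] at hτ
      exact mul_left_cancel₀ (by simpa using hfq0) hτ

/-- A quadratic polynomial map has a polynomial square root generator, on which the involution acts
by `-1`. -/
theorem exists_isSquareRootGenerator [CharZero K] (hdeg : mapDegree f = 2)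
    (τ : RatFunField K n ≃ₐ[subfieldOf f] RatFunField K n) (hτ : τ ≠ 1) :
    ∃ d s : MvPolynomial (Fin n) K, IsSquareRootGenerator
      (aeval f : MvPolynomial (Fin n) K →ₐ[K] MvPolynomial (Fin n) K).toRingHom d s ∧
      τ (algebraMap _ _ s) = -algebraMap _ _ s ∧ s ≠ 0 := by
  have hinj : Function.Injective (aeval f : MvPolynomial (Fin n) K →ₐ[K] MvPolynomial (Fin n) K) :=
    algebraicIndependent_of_mapDegree_ne_zero (by omega)
  have hι := IsFractionRing.injective (MvPolynomial (Fin n) K) (RatFunField K n)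
  have : CharZero (RatFunField K n) := charZero_of_injective_algebraMap (R := K)
    (algebraMap K (RatFunField K n)).injective
  obtain ⟨s₀, hs₀, hτs₀⟩ := exists_ne_zero_apply_eq_neg hdeg τ hτ
  obtain ⟨α, hα⟩ := exists_sq_eq_of_apply_eq_neg hdeg τ hs₀ hτs₀
  obtain ⟨u, v, hv, huv⟩ := exists_eq_div α
  -- With s₀² = u/v, scaling by v makes the square the polynomial φ(u v); integral closedness then
  -- makes s₀ v polynomial.
  have hsq : (s₀ * algebraMap _ _ (aeval f v)) ^ 2 =
      algebraMap (MvPolynomial (Fin n) K) (RatFunField K n) (aeval f (u * v)) := by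
    rw [mul_pow, hα, map_mul, map_mul, ← huv]
    change (α : RatFunField K n) * _ = _
    ring
  obtain ⟨s₁, hs₁⟩ := IsIntegrallyClosed.exists_algebraMap_eq_of_isIntegral_pow
    (R := MvPolynomial (Fin n) K) two_pos (hsq ▸ isIntegral_algebraMap)
  obtain ⟨d, s, hs0, hs, hd, hτs⟩ := exists_squarefree_radicand hinj τ _ (u * v) s₁ rfl
    (by
      rintro rfl
      rw [map_zero, eq_comm, mul_eq_zero] at hs₁
      exact hs₁.elim hs₀ (by simpa using hv))
    (hι (by rw [map_pow, hs₁, hsq]))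
    (by rw [hs₁, map_mul, hτs₀, apply_algebraMap_aeval, neg_mul])
  have hs0' : algebraMap (MvPolynomial (Fin n) K) (RatFunField K n) s ≠ 0 := by simpa using hs0
  refine ⟨d, s, ⟨hs, hd, fun r => ?_, fun a b hab => ?_⟩, hτs, hs0⟩
  · obtain ⟨α, β, h⟩ := exists_eq_add_mul_of_apply_eq_neg hdeg τ hs0' hτs (algebraMap _ _ r)
    obtain ⟨a, c, hc, hac⟩ := exists_eq_div α
    obtain ⟨b, c', hc', hbc⟩ := exists_eq_div β
    refine ⟨a * c', b * c, c * c', ?_, hι ?_⟩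
    · rintro h0
      have := congrArg (aeval f) h0
      rw [map_mul, map_zero, mul_eq_zero] at this
      exact this.elim hc hc'
    · change algebraMap _ _ (aeval f (c * c') * r) =
        algebraMap _ _ (aeval f (a * c') + aeval f (b * c) * s)
      simp only [map_add, map_mul]
      rw [h, ← hac, ← hbc]
      change _ * ((α : RatFunField K n) + (β : RatFunField K n) * _) = _
      ring
  · have h1 : aeval f a + aeval f b * s = 0 := hab
    have h2 := congrArg (algebraMap (MvPolynomial (Fin n) K) (RatFunField K n)) h1
    have h3 := congrArg τ h2
    simp only [map_add, map_mul, apply_algebraMap_aeval, hτs, map_zero] at h2 h3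
    have ha : 2 * algebraMap (MvPolynomial (Fin n) K) (RatFunField K n) (aeval f a) = 0 := by
      linear_combination h2 + h3
    have ha : aeval f a = 0 := by
      apply hι
      rw [map_zero]
      exact (mul_eq_zero.1 ha).resolve_left two_ne_zero
    rw [ha, zero_add, mul_eq_zero, or_iff_left hs0] at h1
    exact ⟨hinj (by rw [ha, map_zero]), hinj (by rw [h1, map_zero])⟩

end Map

/-! ### Comparison of the Jacobian determinant with the square root -/

section Main

/-- Local-to-global: a prime surviving in the reduced denominator of y/x would have to divide the
corresponding c. -/
theorem dvd_of_forall_irreducible {R : Type*} [CommRing R] [IsDomain R]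
    [UniqueFactorizationMonoid R] {x y : R} (hx : x ≠ 0)
    (h : ∀ p, Irreducible p → ∃ c, ¬ p ∣ c ∧ x ∣ y * c) : x ∣ y := by
  obtain ⟨x', y', g, hrel, rfl, rfl⟩ := UniqueFactorizationMonoid.exists_reduced_factors x hx y
  by_cases hu : IsUnit x'
  · exact mul_dvd_mul_left g (hu.dvd)
  obtain ⟨p, hp, hpx⟩ := WfDvdMonoid.exists_irreducible_factor hu (right_ne_zero_of_mul hx)
  obtain ⟨c, hc, hd⟩ := h p hp
  rw [mul_assoc] at hd
  have := (mul_dvd_mul_iff_left (left_ne_zero_of_mul hx)).1 hd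
  exact absurd (hpx.trans (hrel.dvd_of_dvd_mul_left this)) hc

variable {K : Type*} [Field K] {n : ℕ} {f : Fin n → MvPolynomial (Fin n) K}

theorem hypersurface_eq_of_associated {h g : MvPolynomial (Fin n) K} (hg : Associated h g) :
    hypersurface h = hypersurface g := by
  obtain ⟨u, rfl⟩ := hg
  have hu : ∀ a, eval a (u : MvPolynomial (Fin n) K) ≠ 0 := fun a =>
    (u.isUnit.map (eval a)).ne_zero
  ext a
  simp [hypersurface, hu]

variable [IsAlgClosed K] [CharZero K]

/-- Ramified divisors are components of the zero locus of the Jacobian determinant. -/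
theorem dvd_jacobianDet_of_sq_dvd {h H : MvPolynomial (Fin n) K} (hh : Irreducible h)
    (hH : Irreducible H) (hc : ¬ IsContracted f (hypersurface h)) (hhH : h ^ 2 ∣ aeval f H) :
    h ∣ jacobianDet f := by
  obtain ⟨k, hk⟩ := exists_pderiv_ne_zero hH.ne_zero hH.not_isUnit
  refine dvd_jacobianDet hh (k := k) (fun hd => hk ?_) hhH
  exact eq_zero_of_dvd_pderiv
    (dvd_of_not_isContracted hh hH hc ((dvd_pow_self h two_ne_zero).trans hhH) hd)

theorem associated_jacobianDet (hcontr : NoContractedDivisors f)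
    (hφ : PreservesDivisors
      (aeval f : MvPolynomial (Fin n) K →ₐ[K] MvPolynomial (Fin n) K).toRingHom)
    {d s : MvPolynomial (Fin n) K}
    (hs : IsSquareRootGenerator
      (aeval f : MvPolynomial (Fin n) K →ₐ[K] MvPolynomial (Fin n) K).toRingHom d s)
    (hd : Irreducible d) : Associated (jacobianDet f) s := by
  have hirr : Irreducible s := hs.irreducible_root hφ hd
  have hloc : ∀ p, Irreducible p → ∃ c, ¬ p ∣ c ∧ jacobianDet f ∣ s * c := by
    intro p hp
    choose a b a' b' hn he using fun i =>
      hs.exists_localized hφ isUnit_two_mvPolynomial hp (X i)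
    refine ⟨_, fun hdvd => ?_, jacobianDet_dvd hs.sq_eq hirr.ne_zero a b a' b' he⟩
    obtain ⟨i, -, hi⟩ := (Prime.dvd_finsetProd_iff hp.prime _).1 hdvd
    exact hn i hi
  -- The local bound at the prime s itself excludes a vanishing determinant.
  have hJ : jacobianDet f ≠ 0 := by
    intro h0
    obtain ⟨c, hc, hdvd⟩ := hloc s hirr
    rw [h0, zero_dvd_iff, mul_eq_zero] at hdvd
    exact hdvd.elim hirr.ne_zero fun h => hc (h ▸ dvd_zero _)
  exact associated_of_dvd_dvd (dvd_of_forall_irreducible hJ hloc)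
    (dvd_jacobianDet_of_sq_dvd hirr hd (hcontr s hirr) (dvd_of_eq hs.sq_eq))

/-- A constant d has a square root in K, so s would be constant and fixed by τ, contradicting τ s =
-s in characteristic zero. -/
theorem not_isUnit_radicand {d s : MvPolynomial (Fin n) K} (hs : s ^ 2 = aeval f d) (hs0 : s ≠ 0)
    (τ : RatFunField K n ≃ₐ[subfieldOf f] RatFunField K n)
    (hτ : τ (algebraMap _ _ s) = -algebraMap _ _ s) : ¬ IsUnit d := by
  intro hd
  obtain ⟨c, hc, rfl⟩ := isUnit_iff_exists_C.1 hd
  obtain ⟨e, rfl⟩ := IsAlgClosed.exists_pow_nat_eq c two_pos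
  have h1 : s ^ 2 = (C e) ^ 2 := by rw [hs, algHom_C, map_pow]; rfl
  obtain ⟨e', rfl⟩ : ∃ e', s = C e' := by
    rcases sq_eq_sq_iff_eq_or_eq_neg.1 h1 with h | h
    · exact ⟨e, h⟩
    · exact ⟨-e, by rw [h, C_neg]⟩
  have h2 := apply_algebraMap_aeval τ (C e')
  rw [algHom_C] at h2
  have h3 : algebraMap (MvPolynomial (Fin n) K) (RatFunField K n) (C e') =
    -algebraMap _ _ (C e') := h2.symm.trans hτ
  rw [← map_neg] at h3
  have h4 := IsFractionRing.injective (MvPolynomial (Fin n) K) (RatFunField K n) h3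
  rw [← C_neg] at h4
  have h5 := C_injective _ _ h4
  exact hs0 (by rw [self_eq_neg.1 h5, C_0])

end Main
end

theorem theorem4p1 {K : Type*} [Field K] [IsAlgClosed K] [CharZero K] (n : ℕ)
    (f : Fin n → MvPolynomial (Fin n) K)
    (hdeg : mapDegree f = 2) (hcontr : NoContractedDivisors f)
    (τ : RatFunField K n ≃ₐ[subfieldOf f] RatFunField K n) (hτ : τ ≠ 1) :
    Irreducible (jacobianDet f) ∧
      τ (algebraMap (MvPolynomial (Fin n) K) (RatFunField K n) (jacobianDet f)) =
        -algebraMap (MvPolynomial (Fin n) K) (RatFunField K n) (jacobianDet f) ∧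
      ∀ X : Set (Fin n → K), IsBranchingDivisor f X ↔ X = hypersurface (jacobianDet f) := by
  have hφ := preservesDivisors_aeval (f := f) (by omega) hcontr
  obtain ⟨d, s, hs, hτs, hs0⟩ := exists_isSquareRootGenerator hdeg τ hτ
  have hd : Irreducible d := by
    refine hs.irreducible_radicand hφ isUnit_two_mvPolynomial (fun u hu => ?_)
      (not_isUnit_radicand hs.sq_eq hs0 τ hτs)
    obtain ⟨c, hc, rfl⟩ := isUnit_iff_exists_C.1 hu
    exact ⟨MvPolynomial.C c, hu, (MvPolynomial.algHom_C (MvPolynomial.aeval f) c).symm⟩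
  have hJs := associated_jacobianDet hcontr hφ hs hd
  have hJ : Irreducible (jacobianDet f) := hJs.irreducible_iff.2 (hs.irreducible_root hφ hd)
  refine ⟨hJ, ?_, fun X => ⟨?_, ?_⟩⟩
  -- The determinant is a nonzero constant times s, and τ fixes constants.
  · obtain ⟨u, hu⟩ := hJs.symm
    obtain ⟨c, hc, huc⟩ := isUnit_iff_exists_C.1 u.isUnit
    have h2 := apply_algebraMap_aeval τ (MvPolynomial.C c)
    rw [MvPolynomial.algHom_C] at h2
    change τ (algebraMap _ _ (MvPolynomial.C c)) = algebraMap _ _ (MvPolynomial.C c) at h2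
    rw [← hu, huc, map_mul, map_mul, hτs, h2, neg_mul]
  · rintro ⟨h, hh, rfl, hc, H, ⟨hH, -⟩, hhH⟩
    exact hypersurface_eq_of_associated
      (hh.associated_of_dvd hJ (dvd_jacobianDet_of_sq_dvd hh hH hc hhH))
  · rintro rfl
    have hdvd : jacobianDet f ^ 2 ∣ MvPolynomial.aeval f d :=
      (hJs.pow_pow (n := 2)).dvd.trans (dvd_of_eq hs.sq_eq)
    exact ⟨_, hJ, rfl, hcontr _ hJ, d, ⟨hd, (dvd_pow_self _ two_ne_zero).trans hdvd⟩, hdvd⟩
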